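/- \textbf{Proposition (indexability).} Consider one user with channel success probability $\rho\in(0,1]$, source transition probability $p\in[0,1]$ and inter-state distance $d>0$. Its one-dimensional relaxed problem with Lagrange parameter $W\ge 0$ is the following average-cost Markov decision process. The states are $b^j=dp\,\frac{j(j+1)}{2}$, $j\in\{0,1,2,\dots\}$ (the index $j$ is the state variable). In state $b^j$ the passive action ($a=0$) leads to $b^{j+1}$; the active action ($a=1$) leads to $b^0$ with probability $\rho$ and to $b^{j+1}$ with probability $1-\rho$. The cost of a slot is $s+Wa$, where $s$ is the current state and $a$ the action. The objective is to minimize $$\limsup_{T\to\infty}\frac1T\,\mathbb E^{\phi}\Big[\sum_{t=0}^{T-1}\big(s(t)+W a(t)\big)\,\Big|\,s(0)\Big]$$ over all causal (history-dependent, possibly randomized) policies $\phi$. For every $W\ge0$ the optimal value is a real number $\theta$ that does not depend on $s(0)$, and there is a function $V$, bounded below and unique up to an additive constant among functions bounded below, such that for all $j\ge 0$ $$\theta+V(b^j)=\min\big\{\,b^j+V(b^{j+1}),\;\; b^j+W+\rho V(b^0)+(1-\rho)V(b^{j+1})\,\big\}.$$ Let $D(W)$ be the set of states $b^j$ in which the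 passive action is optimal, i.e. in which the first term attains this minimum. The stationary policy that is passive exactly on $D(W)$ is optimal from every initial state. The problem is indexable: $$0\le W'<W\ \Longrightarrow\ D(W')\subseteq D(W).$$ Moreover, for $n\ge 0$, let $\overline{a^n}=\limsup_{T\to\infty}\frac1T\,\mathbb E\big[\sum_{t=0}^{T-1}a(t)\mid s(0)\big]$ be the average active time of the threshold policy $n$, which is passive in $b^j$ for $j<n$ and active for $j\ge n$. Then, for every initial state, $\overline{a^n}=\frac1{n\rho+1}$, and this is strictly decreasing in $n$. -/

import Mathlib

/-- Parameters of one user: success probability `ρ` of the channel, distance `d` between two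
consecutive states of the source, and probability `p` that the source moves during a slot. -/
structure User where
  ρ : ℝ
  d : ℝ
  p : ℝ
  ρ_pos : 0 < ρ
  ρ_le_one : ρ ≤ 1
  d_pos : 0 < d
  p_nonneg : 0 ≤ p
  p_le_one : p ≤ 1

namespace User

/-- The `j`-th state `b^j = d p j (j + 1) / 2` of the one-dimensional problem, i.e. the mean age of
incorrect information `j` slots after the last successful reception. States are referred to by
their index `j`. -/
noncomputable def penalty (u : User) (j : ℕ) : ℝ :=
  u.d * u.p * ((j : ℝ) * ((j : ℝ) + 1) / 2)

/-- Whether a transmission attempt succeeds: a Bernoulli variable with parameter `ρ`. -/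
noncomputable def channel (u : User) : PMF Bool :=
  PMF.ofFintype (fun c => ENNReal.ofReal (if c then u.ρ else 1 - u.ρ)) (by
    have h : (0 : ℝ) ≤ 1 - u.ρ := sub_nonneg.mpr u.ρ_le_one
    simp [← ENNReal.ofReal_add u.ρ_pos.le h])

/-- Transition probabilities. Action `false` is passive, `true` is active: a passive user moves
from `b^j` to `b^(j+1)`; an active user moves to `b^0` on success and to `b^(j+1)` on failure. -/
noncomputable def transition (u : User) (j : ℕ) (a : Bool) : PMF ℕ :=
  if a then u.channel.map (fun c => if c then 0 else j + 1) else PMF.pure (j + 1)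

end User

/-- A past trajectory: the state-action pairs of the elapsed slots, most recent first. -/
abbrev History := List (ℕ × Bool)

/-- A causal (history-dependent, possibly randomized) policy: the law of the next action, given the
past trajectory and the current state. -/
abbrev Policy := History → ℕ → PMF Bool

/-- The stationary deterministic policy that is passive exactly on `D`. -/
noncomputable def passiveOn (D : Set ℕ) : Policy := by
  classical
  exact fun _ j => PMF.pure (if j ∈ D then false else true)

/-- The threshold policy `n`: passive at `b^j` for `j < n`, active for `j ≥ n`. -/
noncomputable def thresholdPolicy (n : ℕ) : Policy :=
  passiveOn {j | j < n}

namespace User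

/-- Joint law of the trajectory `(s(0), a(0)), …, (s(t-1), a(t-1))` and of the current state `s(t)`
under the policy `φ`, started at `s(0) = b^j₀`. -/
noncomputable def law (u : User) (φ : Policy) (j₀ : ℕ) : ℕ → PMF (History × ℕ)
  | 0 => PMF.pure ([], j₀)
  | t + 1 => (law u φ j₀ t).bind fun x =>
      (φ x.1 x.2).bind fun a => (u.transition x.2 a).map fun j => ((x.2, a) :: x.1, j)

/-- The expectation of `∑_{t < T} g (s(t), a(t))` under `φ`. (The law has finite support.) -/
noncomputable def expectedSum (u : User) (g : ℕ × Bool → ℝ) (φ : Policy) (j₀ T : ℕ) : ℝ :=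
  ∑' x : History × ℕ, (u.law φ j₀ T x).toReal * (x.1.map g).sum

/-- `limsup_{T → ∞} (1 / T) E^φ [∑_{t < T} g (s(t), a(t)) | s(0) = b^j₀]`. -/
noncomputable def longRunAverage (u : User) (g : ℕ × Bool → ℝ) (φ : Policy) (j₀ : ℕ) : EReal :=
  Filter.limsup (fun T : ℕ => ((u.expectedSum g φ j₀ T / (T : ℝ) : ℝ) : EReal)) Filter.atTop

/-- The instantaneous cost `s + W a`. -/
noncomputable def cost (u : User) (W : ℝ) (x : ℕ × Bool) : ℝ :=
  u.penalty x.1 + W * (if x.2 then 1 else 0)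

/-- The objective of the one-dimensional relaxed problem with Lagrange parameter `W`. -/
noncomputable def avgCost (u : User) (W : ℝ) (φ : Policy) (j₀ : ℕ) : EReal :=
  u.longRunAverage (u.cost W) φ j₀

/-- The average active time of a policy. -/
noncomputable def avgActiveTime (u : User) (φ : Policy) (j₀ : ℕ) : EReal :=
  u.longRunAverage (fun x => if x.2 then 1 else 0) φ j₀

/-- The optimal value of the one-dimensional relaxed problem, over all causal policies. -/
noncomputable def optimalValue (u : User) (W : ℝ) (j₀ : ℕ) : EReal :=
  ⨅ φ : Policy, u.avgCost W φ j₀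

/-- `φ` solves the one-dimensional relaxed problem, whatever the initial state. -/
def IsOptimal (u : User) (W : ℝ) (φ : Policy) : Prop :=
  ∀ j₀, u.avgCost W φ j₀ = u.optimalValue W j₀

/-- Value of the passive action at `b^j` in the Bellman equation. -/
noncomputable def passiveValue (u : User) (V : ℕ → ℝ) (j : ℕ) : ℝ :=
  u.penalty j + V (j + 1)

/-- Value of the active action at `b^j` in the Bellman equation. -/
noncomputable def activeValue (u : User) (W : ℝ) (V : ℕ → ℝ) (j : ℕ) : ℝ :=
  u.penalty j + W + u.ρ * V 0 + (1 - u.ρ) * V (j + 1)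

/-- `θ` is the optimal value of the problem and `V` is a differential cost-to-go function: the
Bellman equation holds and `V` is bounded below. (The lower bound is the usual requirement when
costs are nonnegative and unbounded; for `ρ = 1` the bare equation has spurious solutions.) -/
structure IsBellmanSolution (u : User) (W θ : ℝ) (V : ℕ → ℝ) : Prop where
  value : ∀ j₀, u.optimalValue W j₀ = (θ : EReal)
  bellman : ∀ j, θ + V j = min (u.passiveValue V j) (u.activeValue W V j)
  bddBelow : BddBelow (Set.range V)

/-- `D(W)`: the set of states in which the passive action is optimal. -/
def passiveSet (u : User) (W : ℝ) : Set ℕ :=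
  {j | ∃ (θ : ℝ) (V : ℕ → ℝ), u.IsBellmanSolution W θ V ∧
    u.passiveValue V j ≤ u.activeValue W V j}

/-- Indexability: `D(W') ⊆ D(W)` whenever `W' < W`. -/
def Indexable (u : User) : Prop :=
  ∀ W' W : ℝ, 0 ≤ W' → W' < W → u.passiveSet W' ⊆ u.passiveSet W

end User

/-! The Bellman equation is solved explicitly. Passivity is optimal in `b^j` iff `ρ (V (j+1) - V 0)
≤ W`. Under threshold `n`, a cycle from `b^0` has mean length `n + 1/ρ` and mean cost `P n + A n +
W/ρ`, with `P = passivePenalty` and `A = activePenalty`; the ratio is `θ`. Past the threshold `ρ V j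
= W + (ρ A j - θ)`, so the right `n` is the one with `ρ A n ≤ θ ≤ ρ A (n+1)`. Clearing denominators,
these signs are those of `passiveGain`, which decreases in `n` when `p > 0` and in which `W` enters
only as `W/ρ`: hence indexability.

Telescoping the Bellman equation along trajectories gives optimality. The upper bound needs only `V
≥ 0`; the lower bound, for every policy, needs `V = O(penalty + 1)`, so that the terminal term is
controlled by the cost of the next slot. Uniqueness of `V` (`bellman_unique`) makes `D(W)` readable
from this one solution. The active time follows from a bounded Poisson equation. -/

namespace PMF

/-! ### Finite-support expectations -/

variable {α β : Type*}

/-- The mean of a real function under a discrete probability law. -/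
noncomputable def mean (q : PMF α) (f : α → ℝ) : ℝ := ∑' x, (q x).toReal * f x

theorem mean_eq_sum {q : PMF α} {s : Finset α} (hs : q.support ⊆ s) (f : α → ℝ) :
    q.mean f = ∑ x ∈ s, (q x).toReal * f x := by
  refine tsum_eq_sum fun x hx => ?_
  have : q x = 0 := by
    by_contra h
    exact hx (hs ((q.mem_support_iff x).2 h))
  simp [this]

theorem mean_pure (a : α) (f : α → ℝ) : (pure a).mean f = f a := by
  rw [mean_eq_sum (s := {a}) (by simp)]
  simp

theorem mean_bind {q : PMF α} {g : α → PMF β} (hq : q.support.Finite)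
    (hg : ∀ a, (g a).support.Finite) (f : β → ℝ) :
    (q.bind g).mean f = q.mean fun a => (g a).mean f := by
  classical
  set s := hq.toFinset with hs
  set t : Finset β := s.biUnion fun a => (hg a).toFinset with ht
  have hsub : ∀ a ∈ s, (g a).support ⊆ t := by
    intro a ha b hb
    simp only [ht, Finset.coe_biUnion, Set.mem_iUnion]
    exact ⟨a, ha, by simpa using hb⟩
  have hbind : (q.bind g).support ⊆ t := by
    intro b hb
    rw [mem_support_bind_iff] at hb
    obtain ⟨a, ha, hb⟩ := hb
    exact hsub a (by simpa [hs] using ha) hb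
  rw [mean_eq_sum hbind, mean_eq_sum (s := s) (by simp [hs])]
  have h1 : ∀ b, ((q.bind g) b).toReal = ∑ a ∈ s, (q a).toReal * (g a b).toReal := by
    intro b
    rw [bind_apply, tsum_eq_sum (s := s), ENNReal.toReal_sum]
    · simp [ENNReal.toReal_mul]
    · exact fun a _ => ENNReal.mul_ne_top (q.apply_ne_top a) ((g a).apply_ne_top b)
    · intro a ha
      have : q a = 0 := by simpa [hs] using ha
      simp [this]
  simp_rw [h1, Finset.sum_mul]
  rw [Finset.sum_comm]
  refine Finset.sum_congr rfl fun a ha => ?_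
  rw [mean_eq_sum (hsub a ha), Finset.mul_sum]
  exact Finset.sum_congr rfl fun b _ => by ring

theorem finite_support_bind {q : PMF α} {g : α → PMF β} (hq : q.support.Finite)
    (hg : ∀ a, (g a).support.Finite) : (q.bind g).support.Finite := by
  rw [support_bind]
  exact hq.biUnion fun a _ => hg a

theorem finite_support_map {q : PMF α} (hq : q.support.Finite) (h : α → β) :
    (q.map h).support.Finite := by
  rw [support_map]
  exact hq.image h

theorem mean_map {q : PMF α} (hq : q.support.Finite) (h : α → β) (f : β → ℝ) :
    (q.map h).mean f = q.mean fun a => f (h a) := by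
  rw [← bind_pure_comp, mean_bind hq fun a => by simp]
  simp [mean_pure]

theorem mean_add {q : PMF α} (hq : q.support.Finite) (f g : α → ℝ) :
    q.mean (fun x => f x + g x) = q.mean f + q.mean g := by
  have hs : q.support ⊆ hq.toFinset := by simp
  simp_rw [mean_eq_sum hs, mul_add, Finset.sum_add_distrib]

theorem mean_const_mul (q : PMF α) (c : ℝ) (f : α → ℝ) :
    q.mean (fun x => c * f x) = c * q.mean f := by
  simp_rw [mean, ← tsum_mul_left]
  exact tsum_congr fun x => by ring

theorem mean_const (q : PMF α) (c : ℝ) : q.mean (fun _ => c) = c := by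
  rw [mean, tsum_mul_right, ← ENNReal.tsum_toReal_eq q.apply_ne_top, q.tsum_coe]
  simp

theorem mean_mono {q : PMF α} (hq : q.support.Finite) {f g : α → ℝ} (h : ∀ x, f x ≤ g x) :
    q.mean f ≤ q.mean g := by
  have hs : q.support ⊆ hq.toFinset := by simp
  rw [mean_eq_sum hs, mean_eq_sum hs]
  exact Finset.sum_le_sum fun x _ => mul_le_mul_of_nonneg_left (h x) ENNReal.toReal_nonneg

end PMF

/-! ### Long-run averages of sequences with affine bounds -/

section Averages

open Filter Topology

theorem tendsto_affine_div (θ K : ℝ) :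
    Tendsto (fun T : ℕ => (((θ * T + K) / (T : ℝ) : ℝ) : EReal)) atTop (𝓝 (θ : EReal)) := by
  refine (continuous_coe_real_ereal.tendsto θ).comp ?_
  have h : Tendsto (fun T : ℕ => θ + K / (T : ℝ)) atTop (𝓝 (θ + 0)) :=
    tendsto_const_nhds.add (tendsto_const_div_atTop_nhds_zero_nat K)
  rw [add_zero] at h
  refine h.congr' ?_
  filter_upwards [eventually_gt_atTop 0] with T hT
  have : (T : ℝ) ≠ 0 := by positivity
  field_simp

theorem limsup_div_le_of_le_affine {x : ℕ → ℝ} {θ K : ℝ} (h : ∀ T : ℕ, x T ≤ θ * T + K) :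
    limsup (fun T : ℕ => ((x T / (T : ℝ) : ℝ) : EReal)) atTop ≤ θ := by
  rw [← (tendsto_affine_div θ K).limsup_eq]
  refine limsup_le_limsup (Eventually.of_forall fun T => ?_)
  exact EReal.coe_le_coe_iff.2 (div_le_div_of_nonneg_right (h T) (Nat.cast_nonneg T))

theorem le_limsup_div_of_affine_le {x : ℕ → ℝ} {θ K : ℝ} (h : ∀ T : ℕ, θ * T + K ≤ x T) :
    (θ : EReal) ≤ limsup (fun T : ℕ => ((x T / (T : ℝ) : ℝ) : EReal)) atTop := by
  rw [← (tendsto_affine_div θ K).limsup_eq]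
  refine limsup_le_limsup (Eventually.of_forall fun T => ?_)
  exact EReal.coe_le_coe_iff.2 (div_le_div_of_nonneg_right (h T) (Nat.cast_nonneg T))

/-- If the terminal reward `v` is controlled by the increments of the total cost `x`, it does not
affect the long-run average: otherwise `x` would grow superlinearly. -/
theorem le_limsup_div_of_increment_bound {x v : ℕ → ℝ} {θ K C : ℝ} (hC : 0 < C)
    (h : ∀ T : ℕ, θ * T + K ≤ x T + v T) (hv : ∀ T, v T ≤ C * (x (T + 1) - x T + 1)) :
    (θ : EReal) ≤ limsup (fun T : ℕ => ((x T / (T : ℝ) : ℝ) : EReal)) atTop := by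
  by_contra! hlt
  obtain ⟨r, hr, hrθ⟩ := EReal.lt_iff_exists_real_btwn.1 hlt
  have hrθ : 0 < θ - r := sub_pos.2 (EReal.coe_lt_coe_iff.1 hrθ)
  obtain ⟨N, hN⟩ := eventually_atTop.1
    ((eventually_lt_of_limsup_lt hr).and (eventually_gt_atTop 0))
  have hx : ∀ T ≥ N, x T < r * T := fun T hT =>
    (div_lt_iff₀ (Nat.cast_pos.2 (hN T hT).2)).1 (EReal.coe_lt_coe_iff.1 (hN T hT).1)
  -- Since `x T < r T`, one has `v T ≥ (θ - r) T + K`, at least `C (r + 2)` once `T ≥ M`; `hv` then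
  -- forces increments of at least `r + 1`, against `x T < r T`.
  obtain ⟨M, hM⟩ := exists_nat_ge ((C * (r + 2) - K) / (θ - r))
  rw [div_le_iff₀ hrθ] at hM
  have hinc : ∀ T ≥ max N M, r + 1 ≤ x (T + 1) - x T := by
    intro T hT
    have hMT : (M : ℝ) ≤ T := Nat.cast_le.2 (le_of_max_le_right hT)
    have h1 := hx T (le_of_max_le_left hT)
    have h2 := h T
    have h3 := hv T
    have h4 := mul_le_mul_of_nonneg_right hMT hrθ.le
    have h5 : C * (r + 2) ≤ C * (x (T + 1) - x T + 1) := by linarith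
    linarith [le_of_mul_le_mul_left h5 hC]
  have hgrow : ∀ i : ℕ, x (max N M) + (r + 1) * i ≤ x (max N M + i) := by
    intro i
    induction i with
    | zero => simp
    | succ i ih =>
      have := hinc (max N M + i) (Nat.le_add_right _ _)
      push_cast
      rw [← add_assoc]
      linarith
  obtain ⟨i, hi⟩ := exists_nat_ge (r * (max N M : ℕ) - x (max N M))
  have h1 := hx (max N M + i) (le_add_right (le_max_left _ _))
  have h2 := hgrow i
  push_cast at h1 hi
  linarith

end Averages

namespace User

variable (u : User)

/-! ### Verification inequalities for arbitrary policies -/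

section Verification

theorem mean_transition (j : ℕ) (a : Bool) (V : ℕ → ℝ) :
    (u.transition j a).mean V = if a then u.ρ * V 0 + (1 - u.ρ) * V (j + 1) else V (j + 1) := by
  cases a
  · simp [transition, PMF.mean_pure]
  · simp only [transition, if_true]
    rw [PMF.mean_map (Set.toFinite _), PMF.mean_eq_sum (s := Finset.univ) fun c _ => Finset.mem_coe.2 (Finset.mem_univ c)]
    have h : (0 : ℝ) ≤ 1 - u.ρ := sub_nonneg.mpr u.ρ_le_one
    simp [channel, u.ρ_pos.le, h]

theorem finite_support_transition (j : ℕ) (a : Bool) : (u.transition j a).support.Finite := by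
  cases a
  · simp [transition]
  · simp only [transition, if_true]
    exact PMF.finite_support_map (Set.toFinite _) _

theorem finite_support_step (φ : Policy) (x : History × ℕ) :
    ((φ x.1 x.2).bind fun a =>
      (u.transition x.2 a).map fun j => ((x.2, a) :: x.1, j)).support.Finite :=
  PMF.finite_support_bind (Set.toFinite _) fun a =>
    PMF.finite_support_map (u.finite_support_transition x.2 a) _

theorem finite_support_law (φ : Policy) (j₀ t : ℕ) : (u.law φ j₀ t).support.Finite := by
  induction t with
  | zero => simp [law]
  | succ t ih => exact PMF.finite_support_bind ih (u.finite_support_step φ)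

theorem mean_law_succ (φ : Policy) (j₀ t : ℕ) (F : History × ℕ → ℝ) :
    (u.law φ j₀ (t + 1)).mean F = (u.law φ j₀ t).mean fun x => (φ x.1 x.2).mean fun a =>
      (u.transition x.2 a).mean fun j => F ((x.2, a) :: x.1, j) := by
  rw [law, PMF.mean_bind (u.finite_support_law φ j₀ t) (u.finite_support_step φ)]
  congr 1
  funext x
  rw [PMF.mean_bind (Set.toFinite _) fun a =>
    PMF.finite_support_map (u.finite_support_transition x.2 a) _]
  congr 1
  funext a
  exact PMF.mean_map (u.finite_support_transition x.2 a) _ _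

variable (g : ℕ × Bool → ℝ) (φ : Policy) (j₀ : ℕ)

/-- Mean of the terminal reward `V (s(T))`. -/
noncomputable def terminalMean (V : ℕ → ℝ) (T : ℕ) : ℝ := (u.law φ j₀ T).mean fun x => V x.2

theorem expectedSum_zero : u.expectedSum g φ j₀ 0 = 0 :=
  (PMF.mean_pure (([], j₀) : History × ℕ) fun x => (x.1.map g).sum).trans (by simp)

theorem terminalMean_zero (V : ℕ → ℝ) : u.terminalMean φ j₀ V 0 = V j₀ :=
  PMF.mean_pure (([], j₀) : History × ℕ) fun x => V x.2

/-- The tower property over one slot: the induction step of all telescoping below. -/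
theorem expectedSum_succ_add_terminalMean (V : ℕ → ℝ) (T : ℕ) :
    u.expectedSum g φ j₀ (T + 1) + u.terminalMean φ j₀ V (T + 1) =
      u.expectedSum g φ j₀ T + (u.law φ j₀ T).mean fun x => (φ x.1 x.2).mean fun a =>
        g (x.2, a) + (u.transition x.2 a).mean V := by
  have hT := u.finite_support_law φ j₀ T
  have h : ∀ t, u.expectedSum g φ j₀ t = (u.law φ j₀ t).mean fun x => (x.1.map g).sum :=
    fun _ => rfl
  rw [h, h, terminalMean, ← PMF.mean_add (u.finite_support_law φ j₀ _), mean_law_succ,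
    ← PMF.mean_add hT]
  congr 1
  funext x
  conv_rhs => rw [← PMF.mean_const (φ x.1 x.2) (x.1.map g).sum, ← PMF.mean_add (Set.toFinite _)]
  congr 1
  funext a
  rw [PMF.mean_add (u.finite_support_transition x.2 a)]
  simp only [List.map_cons, List.sum_cons, PMF.mean_const]
  ring

variable {g φ} {θ : ℝ} {V : ℕ → ℝ}

theorem affine_le_expectedSum
    (h : ∀ H j, θ + V j ≤ (φ H j).mean fun a => g (j, a) + (u.transition j a).mean V) (T : ℕ) :
    θ * T + V j₀ ≤ u.expectedSum g φ j₀ T + u.terminalMean φ j₀ V T := by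
  induction T with
  | zero => simp [expectedSum_zero, terminalMean_zero]
  | succ T ih =>
    have hT := u.finite_support_law φ j₀ T
    rw [expectedSum_succ_add_terminalMean]
    have h1 := PMF.mean_mono hT fun x => h x.1 x.2
    rw [PMF.mean_add hT, PMF.mean_const] at h1
    rw [terminalMean] at ih
    push_cast
    linarith

theorem expectedSum_le_affine
    (h : ∀ H j, (φ H j).mean (fun a => g (j, a) + (u.transition j a).mean V) ≤ θ + V j) (T : ℕ) :
    u.expectedSum g φ j₀ T + u.terminalMean φ j₀ V T ≤ θ * T + V j₀ := by
  induction T with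
  | zero => simp [expectedSum_zero, terminalMean_zero]
  | succ T ih =>
    have hT := u.finite_support_law φ j₀ T
    rw [expectedSum_succ_add_terminalMean]
    have h1 := PMF.mean_mono hT fun x => h x.1 x.2
    rw [PMF.mean_add hT, PMF.mean_const] at h1
    rw [terminalMean] at ih
    push_cast
    linarith

theorem longRunAverage_le {B : ℝ} (hB : ∀ j, B ≤ V j)
    (h : ∀ H j, (φ H j).mean (fun a => g (j, a) + (u.transition j a).mean V) ≤ θ + V j) :
    u.longRunAverage g φ j₀ ≤ θ := by
  refine limsup_div_le_of_le_affine (K := V j₀ - B) fun T => ?_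
  have h1 := u.expectedSum_le_affine j₀ h T
  have h2 := PMF.mean_mono (u.finite_support_law φ j₀ T) fun x => hB x.2
  rw [PMF.mean_const] at h2
  rw [terminalMean] at h1
  linarith

theorem le_longRunAverage {B : ℝ} (hB : ∀ j, V j ≤ B)
    (h : ∀ H j, θ + V j ≤ (φ H j).mean fun a => g (j, a) + (u.transition j a).mean V) :
    θ ≤ u.longRunAverage g φ j₀ := by
  refine le_limsup_div_of_affine_le (K := V j₀ - B) fun T => ?_
  have h1 := u.affine_le_expectedSum j₀ h T
  have h2 := PMF.mean_mono (u.finite_support_law φ j₀ T) fun x => hB x.2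
  rw [PMF.mean_const] at h2
  rw [terminalMean] at h1
  linarith

/-- `V` may be unbounded above, but the mean of `V (s(T))` is at most `C` times one plus the mean
cost of slot `T`, which is an increment of the total cost. -/
theorem le_longRunAverage_of_le_cost {C : ℝ} (hC : 0 < C)
    (hV : ∀ j a, V j ≤ C * (g (j, a) + 1))
    (h : ∀ j a, θ + V j ≤ g (j, a) + (u.transition j a).mean V) :
    θ ≤ u.longRunAverage g φ j₀ := by
  refine le_limsup_div_of_increment_bound (v := u.terminalMean φ j₀ V) hC
    (u.affine_le_expectedSum j₀ fun H j => ?_) fun T => ?_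
  · rw [← PMF.mean_const (φ H j) (θ + V j)]
    exact PMF.mean_mono (Set.toFinite _) (h j)
  · have hT := u.finite_support_law φ j₀ T
    -- Zero terminal reward identifies the increment with the mean cost of slot `T`.
    have h0 := u.expectedSum_succ_add_terminalMean g φ j₀ (fun _ => 0) T
    simp only [terminalMean, PMF.mean_const, add_zero] at h0
    rw [h0, terminalMean, add_sub_cancel_left, ← PMF.mean_const (u.law φ j₀ T) 1,
      ← PMF.mean_add hT, ← PMF.mean_const_mul]
    refine PMF.mean_mono hT fun x => ?_
    rw [← PMF.mean_const (φ x.1 x.2) 1, ← PMF.mean_add (Set.toFinite _),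
      ← PMF.mean_const_mul, ← PMF.mean_const (φ x.1 x.2) (V x.2)]
    exact PMF.mean_mono (Set.toFinite _) (hV x.2)

end Verification

/-! ### Active time of threshold policies -/

section ActiveTime

theorem mean_passiveOn_of_mem {D : Set ℕ} {j : ℕ} (h : j ∈ D) (H : History) (f : Bool → ℝ) :
    (passiveOn D H j).mean f = f false := by
  simp [passiveOn, PMF.mean_pure, h]

theorem mean_passiveOn_of_notMem {D : Set ℕ} {j : ℕ} (h : j ∉ D) (H : History) (f : Bool → ℝ) :
    (passiveOn D H j).mean f = f true := by
  simp [passiveOn, PMF.mean_pure, h]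

theorem avgActiveTime_thresholdPolicy (n j₀ : ℕ) :
    u.avgActiveTime (thresholdPolicy n) j₀ = ((1 / ((n : ℝ) * u.ρ + 1) : ℝ) : EReal) := by
  have hρ := u.ρ_pos
  have hpos : 0 < (n : ℝ) * u.ρ + 1 := by positivity
  set γ : ℝ := 1 / ((n : ℝ) * u.ρ + 1) with hγ
  have hγ0 : 0 ≤ γ := by positivity
  have hγ1 : γ * (n * u.ρ + 1) = 1 := by rw [hγ]; field_simp
  -- Bounded solution of the Poisson equation: each passive slot raises it by `γ`, and balance in
  -- the active states is exactly `hγ1`.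
  set V : ℕ → ℝ := fun j => γ * (min j n : ℕ) with hV
  have key : ∀ H j, (thresholdPolicy n H j).mean
      (fun a => (if a then 1 else 0) + (u.transition j a).mean V) = γ + V j := by
    intro H j
    by_cases hj : j < n
    · rw [thresholdPolicy, mean_passiveOn_of_mem (by exact hj), mean_transition]
      simp only [hV, Bool.false_eq_true, if_false, min_eq_left hj.le,
        min_eq_left (Nat.succ_le_of_lt hj)]
      push_cast
      ring
    · rw [thresholdPolicy, mean_passiveOn_of_notMem (by exact hj), mean_transition]
      have hj := not_lt.1 hj
      simp only [hV, if_true, min_eq_right hj, min_eq_right (Nat.le_succ_of_le hj)]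
      simp only [Nat.zero_min, Nat.cast_zero]
      linarith
  refine le_antisymm ?_ ?_
  · exact u.longRunAverage_le (V := V) (B := 0) j₀ (fun j => by positivity) fun H j => (key H j).le
  · refine u.le_longRunAverage (V := V) (B := γ * n) j₀ (fun j => ?_) fun H j => (key H j).ge
    exact mul_le_mul_of_nonneg_left (Nat.cast_le.2 (min_le_right _ _)) hγ0

theorem strictAnti_avgActiveTime_thresholdPolicy (j₀ : ℕ) :
    StrictAnti fun n : ℕ => u.avgActiveTime (thresholdPolicy n) j₀ := by
  intro m n hmn
  have hρ := u.ρ_pos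
  simp only [avgActiveTime_thresholdPolicy]
  rw [EReal.coe_lt_coe_iff]
  have : (m : ℝ) < n := Nat.cast_lt.2 hmn
  exact one_div_lt_one_div_of_lt (by positivity) (by gcongr)

end ActiveTime

/-! ### Explicit solution of the Bellman equation -/

section Bellman

/-- Mean total penalty collected from `b^j` until the next successful reception when the user is
always active. -/
noncomputable def activePenalty (j : ℕ) : ℝ :=
  u.d * u.p / 2 * ((j : ℝ) * (j + 1) / u.ρ + (2 * j + 1) * (1 - u.ρ) / u.ρ ^ 2
    + (1 - u.ρ) * (2 - u.ρ) / u.ρ ^ 3)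

/-- Total penalty collected in `b^0, …, b^(j-1)`. -/
noncomputable def passivePenalty (j : ℕ) : ℝ :=
  u.d * u.p * (((j : ℝ) - 1) * j * (j + 1) / 6)

theorem activePenalty_eq (j : ℕ) :
    u.activePenalty j = u.penalty j + (1 - u.ρ) * u.activePenalty (j + 1) := by
  have hρ := u.ρ_pos.ne'
  simp only [activePenalty, penalty]
  push_cast
  field_simp
  ring

theorem passivePenalty_succ (j : ℕ) :
    u.passivePenalty (j + 1) = u.passivePenalty j + u.penalty j := by
  simp only [passivePenalty, penalty]
  push_cast
  ring

theorem passivePenalty_zero : u.passivePenalty 0 = 0 := by simp [passivePenalty]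

theorem penalty_nonneg (j : ℕ) : 0 ≤ u.penalty j := by
  have := u.d_pos
  have := u.p_nonneg
  unfold penalty
  positivity

theorem activePenalty_succ (j : ℕ) :
    u.activePenalty (j + 1) = u.activePenalty j + u.d * u.p * ((j : ℝ) * u.ρ + 1) / u.ρ ^ 2 := by
  have hρ := u.ρ_pos.ne'
  simp only [activePenalty]
  push_cast
  field_simp
  ring

theorem monotone_activePenalty : Monotone u.activePenalty := by
  have := u.d_pos
  have := u.p_nonneg
  have := u.ρ_pos
  refine monotone_nat_of_le_succ fun j => ?_
  rw [activePenalty_succ]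
  exact le_add_of_nonneg_right (by positivity)

/-- By monotonicity, replace `A (j+1)` by `A j` in the recursion `activePenalty_eq`. -/
theorem penalty_le_activePenalty (j : ℕ) : u.penalty j ≤ u.ρ * u.activePenalty j := by
  have h1 := u.activePenalty_eq j
  have h2 := mul_le_mul_of_nonneg_left (u.monotone_activePenalty (Nat.le_succ j))
    (sub_nonneg.2 u.ρ_le_one)
  rw [Nat.succ_eq_add_one] at h2
  linarith

theorem exists_activePenalty_le :
    ∃ C, 0 < C ∧ ∀ j, u.activePenalty j ≤ C * (u.penalty j + 1) := by
  have hd := u.d_pos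
  have hp := u.p_nonneg
  have hρ := u.ρ_pos
  have hq := sub_nonneg.2 u.ρ_le_one
  have hq' : 0 ≤ 2 - u.ρ := by linarith
  -- The terms bound the quadratic, linear and constant parts of `activePenalty`; the linear one
  -- uses `d p j ≤ 2 * penalty j`.
  refine ⟨1 / u.ρ + 2 * (1 - u.ρ) / u.ρ ^ 2 + u.activePenalty 0, ?_, fun j => ?_⟩
  · have : 0 ≤ u.activePenalty 0 := by unfold activePenalty; positivity
    positivity
  · have h0 : 0 ≤ u.activePenalty 0 := by unfold activePenalty; positivity
    have h1 : u.activePenalty j =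
        u.penalty j / u.ρ + u.d * u.p * j * (1 - u.ρ) / u.ρ ^ 2 + u.activePenalty 0 := by
      simp only [activePenalty, penalty]
      push_cast
      field_simp
      ring
    have h2 : u.d * u.p * j ≤ 2 * u.penalty j := by
      have : u.d * u.p * (j : ℝ) ^ 2 ≥ 0 := by positivity
      simp only [penalty]
      linarith
    have h3 : u.d * u.p * j * (1 - u.ρ) / u.ρ ^ 2 ≤ 2 * u.penalty j * (1 - u.ρ) / u.ρ ^ 2 := by
      gcongr
    have h4 := mul_nonneg h0 (u.penalty_nonneg j)
    have h5 : 0 ≤ 1 / u.ρ + 2 * (1 - u.ρ) / u.ρ ^ 2 := by positivity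
    calc u.activePenalty j ≤ u.penalty j / u.ρ + 2 * u.penalty j * (1 - u.ρ) / u.ρ ^ 2
          + u.activePenalty 0 := by linarith
      _ = (1 / u.ρ + 2 * (1 - u.ρ) / u.ρ ^ 2 + u.activePenalty 0) * (u.penalty j + 1)
          - u.activePenalty 0 * u.penalty j - (1 / u.ρ + 2 * (1 - u.ρ) / u.ρ ^ 2) := by ring
      _ ≤ _ := by linarith

/-- The sign of this quantity tells whether it pays to stay passive in `b^(n-1)`. -/
noncomputable def passiveGain (W : ℝ) (n : ℕ) : ℝ :=
  u.passivePenalty n - n * u.ρ * u.activePenalty n + W / u.ρ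

/-- In this form the sign is that of `θ - ρ A (n+1)`, where `θ` is the average cost of threshold
`n`. -/
theorem passiveGain_succ (W : ℝ) (n : ℕ) : u.passiveGain W (n + 1) =
    u.passivePenalty n + u.activePenalty n + W / u.ρ - (n * u.ρ + 1) * u.activePenalty (n + 1) := by
  rw [passiveGain, passivePenalty_succ, u.activePenalty_eq n]
  push_cast
  ring

theorem passiveGain_succ_eq_sub (W : ℝ) (n : ℕ) : u.passiveGain W (n + 1) =
    u.passiveGain W n - u.d * u.p * ((n : ℝ) * u.ρ + 1) ^ 2 / u.ρ ^ 2 := by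
  rw [passiveGain_succ, passiveGain, activePenalty_succ]
  ring

theorem passiveGain_zero (W : ℝ) : u.passiveGain W 0 = W / u.ρ := by
  simp [passiveGain, passivePenalty_zero]

/-- A solution of the Bellman equation normalised to vanish at `b^0`, nonnegative, of at most the
order of the penalty, and whose passive states are given by the sign of `passiveGain`. -/
structure IsNormalizedSolution (W θ : ℝ) (V : ℕ → ℝ) : Prop where
  zero : V 0 = 0
  nonneg : ∀ j, 0 ≤ V j
  bellman : ∀ j, θ + V j = min (u.passiveValue V j) (u.activeValue W V j)
  passive_iff : ∀ j, u.passiveValue V j ≤ u.activeValue W V j ↔ 0 ≤ u.passiveGain W (j + 1)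
  growth : ∃ C, 0 < C ∧ ∀ j, V j ≤ C * (u.penalty j + 1)

theorem passiveValue_le_activeValue_iff {W : ℝ} {V : ℕ → ℝ} (j : ℕ) :
    u.passiveValue V j ≤ u.activeValue W V j ↔ u.ρ * (V (j + 1) - V 0) ≤ W := by
  unfold passiveValue activeValue
  constructor <;> intro h <;> linarith

/-- Treated apart: here `passiveGain` is constantly `W/ρ`, so for `W > 0` no finite threshold
exists. -/
theorem isNormalizedSolution_of_p_eq_zero (hp : u.p = 0) {W : ℝ} (hW : 0 ≤ W) :
    u.IsNormalizedSolution W 0 fun _ => 0 := by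
  have hpen : ∀ j, u.penalty j = 0 := fun j => by simp [penalty, hp]
  refine ⟨rfl, fun _ => le_rfl, fun j => ?_, fun j => ?_, 1, one_pos, fun j => ?_⟩
  · simp [passiveValue, activeValue, hpen, hW]
  · have : 0 ≤ W / u.ρ := div_nonneg hW u.ρ_pos.le
    simp [passiveValue, activeValue, hpen, hW, passiveGain, passivePenalty, activePenalty, hp, this]
  · simp [hpen]

theorem strictAnti_passiveGain (hp : 0 < u.p) (W : ℝ) : StrictAnti (u.passiveGain W) := by
  have := u.d_pos
  have := u.ρ_pos
  refine strictAnti_nat_of_succ_lt fun n => ?_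
  rw [passiveGain_succ_eq_sub]
  exact sub_lt_self _ (by positivity)

theorem exists_passiveGain_succ_nonpos (hp : 0 < u.p) (W : ℝ) :
    ∃ n, u.passiveGain W (n + 1) ≤ 0 := by
  have hd := u.d_pos
  have hρ := u.ρ_pos
  set c := u.d * u.p / u.ρ ^ 2 with hc
  have hcpos : 0 < c := by positivity
  have hle : ∀ n : ℕ, u.passiveGain W n ≤ W / u.ρ - n * c := by
    intro n
    induction n with
    | zero => simp [passiveGain_zero]
    | succ n ih =>
      have h1 : (1 : ℝ) ≤ ((n : ℝ) * u.ρ + 1) ^ 2 := by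
        have : (0 : ℝ) ≤ n * u.ρ := by positivity
        nlinarith
      have h2 : u.d * u.p * ((n : ℝ) * u.ρ + 1) ^ 2 / u.ρ ^ 2 = c * ((n : ℝ) * u.ρ + 1) ^ 2 := by
        rw [hc]; ring
      have h3 := mul_le_mul_of_nonneg_left h1 hcpos.le
      rw [passiveGain_succ_eq_sub, h2]
      push_cast
      linarith
  obtain ⟨n, hn⟩ := exists_nat_ge (W / u.ρ / c)
  rw [div_le_iff₀ hcpos] at hn
  refine ⟨n, (hle (n + 1)).trans ?_⟩
  push_cast
  linarith

theorem exists_isNormalizedSolution_of_p_pos (hp : 0 < u.p) {W : ℝ} (hW : 0 ≤ W) :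
    ∃ θ V, u.IsNormalizedSolution W θ V := by
  classical
  have hρ := u.ρ_pos
  have hq := sub_nonneg.2 u.ρ_le_one
  have hWρ : 0 ≤ W / u.ρ := div_nonneg hW hρ.le
  have hanti := u.strictAnti_passiveGain hp W
  obtain ⟨n, hn, hmin⟩ : ∃ n, u.passiveGain W (n + 1) ≤ 0 ∧
      ∀ m < n, 0 < u.passiveGain W (m + 1) := by
    have hex := u.exists_passiveGain_succ_nonpos hp W
    exact ⟨Nat.find hex, Nat.find_spec hex, fun m hm => not_le.1 (Nat.find_min hex hm)⟩
  have hn0 : 0 ≤ u.passiveGain W n := by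
    cases n with
    | zero => rwa [passiveGain_zero]
    | succ m => exact (hmin m m.lt_succ_self).le
  have hden : 0 < (n : ℝ) * u.ρ + 1 := by positivity
  -- Mean cost per cycle over mean cycle length, scaled by `ρ`.
  obtain ⟨θ, hθ⟩ : ∃ θ : ℝ, θ * (n * u.ρ + 1) =
      u.ρ * (u.passivePenalty n + u.activePenalty n + W / u.ρ) :=
    ⟨_, div_mul_cancel₀ _ hden.ne'⟩
  have hlow : u.ρ * u.activePenalty n ≤ θ := by
    refine le_of_mul_le_mul_right ?_ hden
    rw [hθ]
    have := mul_nonneg hρ.le hn0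
    rw [passiveGain] at this
    linarith
  have hupp_iff : u.ρ * u.activePenalty (n + 1) ≤ θ ↔ 0 ≤ u.passiveGain W (n + 1) := by
    rw [← mul_le_mul_iff_left₀ hden, hθ, passiveGain_succ, mul_assoc, mul_le_mul_iff_right₀ hρ]
    constructor <;> intro h <;> linarith
  have hupp : θ ≤ u.ρ * u.activePenalty (n + 1) := by
    refine le_of_mul_le_mul_right ?_ hden
    rw [hθ, mul_assoc, mul_le_mul_iff_right₀ hρ]
    rw [passiveGain_succ] at hn
    linarith
  have hWdiv : u.ρ * (W / u.ρ) = W := by field_simp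
  have hθdiv : u.ρ * (θ / u.ρ) = θ := by field_simp
  -- Below `n`, sum the passive equation from `V 0 = 0`; above, the excess cost until the next
  -- success. The choice of `θ` makes both agree at `n`.
  set V : ℕ → ℝ := fun j => if j ≤ n then θ * j - u.passivePenalty j
    else u.activePenalty j + W / u.ρ - θ / u.ρ with hVdef
  have hVle : ∀ j, j ≤ n → V j = θ * j - u.passivePenalty j := fun j hj => if_pos hj
  have hVge : ∀ j, n ≤ j → V j = u.activePenalty j + W / u.ρ - θ / u.ρ := by
    intro j hj
    rcases hj.eq_or_lt with rfl | hj
    · rw [hVle _ le_rfl]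
      refine mul_left_cancel₀ hρ.ne' ?_
      linarith
    · exact if_neg (not_le.2 hj)
  have hV0 : V 0 = 0 := by simp [hVle 0 n.zero_le, passivePenalty_zero]
  have hstep : ∀ j < n, V (j + 1) = V j + (θ - u.penalty j) := by
    intro j hj
    rw [hVle _ (Nat.succ_le_of_lt hj), hVle _ hj.le, passivePenalty_succ]
    push_cast
    ring
  have hstep_nonneg : ∀ j ≤ n, 0 ≤ θ - u.penalty j := by
    intro j hj
    have h1 := u.penalty_le_activePenalty j
    have h2 := mul_le_mul_of_nonneg_left (u.monotone_activePenalty hj) hρ.le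
    linarith
  have hVmono : ∀ j k, j ≤ k → k ≤ n → V j ≤ V k := by
    intro j k hjk
    induction k, hjk using Nat.le_induction with
    | base => exact fun _ => le_rfl
    | succ k _ ih =>
      intro hk
      have := hstep_nonneg k (by omega)
      rw [hstep k hk]
      linarith [ih (by omega)]
  have hρV : ∀ j, n ≤ j → u.ρ * V j = W + (u.ρ * u.activePenalty j - θ) := by
    intro j hj
    rw [hVge j hj]
    linarith
  have hpassive : ∀ j ≤ n, u.ρ * V j ≤ W := by
    intro j hj
    have h1 := mul_le_mul_of_nonneg_left (hVmono j n hj le_rfl) hρ.le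
    have h2 := hρV n le_rfl
    linarith
  have hactive : ∀ j, n ≤ j → W ≤ u.ρ * V (j + 1) := by
    intro j hj
    have h1 := hρV (j + 1) (by omega)
    have h2 := mul_le_mul_of_nonneg_left
      (u.monotone_activePenalty (Nat.add_le_add_right hj 1)) hρ.le
    linarith
  have hVnonneg : ∀ j, 0 ≤ V j := by
    intro j
    rcases le_or_gt j n with hj | hj
    · exact hV0 ▸ hVmono 0 j j.zero_le hj
    · obtain ⟨k, rfl⟩ := Nat.exists_eq_add_of_lt hj
      have := hactive (n + k) (by omega)
      exact nonneg_of_mul_nonneg_right (hW.trans this) hρ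
  refine ⟨θ, V, hV0, hVnonneg, fun j => ?_, fun j => ?_, ?_⟩
  · rcases lt_or_ge j n with hj | hj
    · rw [min_eq_left]
      · rw [passiveValue, hstep j hj]
        ring
      · rw [passiveValue_le_activeValue_iff, hV0, sub_zero]
        exact hpassive _ hj
    · rw [min_eq_right]
      · have h1 := hVge j hj
        have h2 := hρV (j + 1) (by omega)
        have h3 := u.activePenalty_eq j
        have h4 := hVge (j + 1) (by omega)
        rw [activeValue, hV0, h1, h4, h3]
        linarith
      · have := hactive j hj
        simp only [passiveValue, activeValue, hV0]
        linarith
  · rw [passiveValue_le_activeValue_iff, hV0, sub_zero]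
    rcases lt_trichotomy j n with hj | rfl | hj
    · exact iff_of_true (hpassive _ hj) (hmin j hj).le
    -- At `j = n` a tie is possible, when `passiveGain` vanishes at `n + 1`; the state then counts
    -- as passive.
    · rw [← hupp_iff, hρV (j + 1) (by omega)]
      constructor <;> intro h <;> linarith
    · refine iff_of_false (not_le.2 ?_)
        (not_le.2 ((hanti (Nat.add_lt_add_right hj 1)).trans_le hn))
      have h1 : u.activePenalty (n + 1) < u.activePenalty (j + 1) := by
        have hd := u.d_pos
        refine lt_of_lt_of_le ?_ (u.monotone_activePenalty (show n + 1 + 1 ≤ j + 1 by omega))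
        rw [u.activePenalty_succ (n + 1)]
        exact lt_add_of_pos_right _ (by positivity)
      have h2 := mul_lt_mul_of_pos_left h1 hρ
      rw [hρV (j + 1) (by omega)]
      linarith
  · obtain ⟨C, hC, hCj⟩ := u.exists_activePenalty_le
    refine ⟨C + W / u.ρ, by positivity, fun j => ?_⟩
    have hpen := u.penalty_nonneg j
    have hmul := mul_nonneg hWρ hpen
    have hCpen := mul_nonneg hC.le hpen
    have hθ0 : 0 ≤ θ / u.ρ :=
      div_nonneg ((u.penalty_nonneg 0).trans (sub_nonneg.1 (hstep_nonneg 0 n.zero_le))) hρ.le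
    rcases le_or_gt j n with hj | hj
    · have h1 : V j ≤ W / u.ρ := (le_div_iff₀' hρ).2 (hpassive j hj)
      linarith
    · rw [hVge j hj.le]
      linarith [hCj j]

theorem exists_isNormalizedSolution {W : ℝ} (hW : 0 ≤ W) :
    ∃ θ V, u.IsNormalizedSolution W θ V := by
  rcases u.p_nonneg.eq_or_lt with hp | hp
  · exact ⟨_, _, u.isNormalizedSolution_of_p_eq_zero hp.symm hW⟩
  · exact u.exists_isNormalizedSolution_of_p_pos hp hW

theorem cost_add_mean_transition (W : ℝ) (V : ℕ → ℝ) (j : ℕ) (a : Bool) :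
    u.cost W (j, a) + (u.transition j a).mean V =
      if a then u.activeValue W V j else u.passiveValue V j := by
  cases a
  · simp [cost, mean_transition, passiveValue]
  · simp only [cost, mean_transition, activeValue, if_true]
    ring

/-! ### Optimality of the explicit policy -/

variable {u} {W θ : ℝ} {V : ℕ → ℝ}

theorem IsNormalizedSolution.le_avgCost (hW : 0 ≤ W) (h : u.IsNormalizedSolution W θ V)
    (φ : Policy) (j₀ : ℕ) : θ ≤ u.avgCost W φ j₀ := by
  obtain ⟨C, hC, hgrowth⟩ := h.growth
  refine u.le_longRunAverage_of_le_cost j₀ hC (fun j a => (hgrowth j).trans ?_) fun j a => ?_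
  · refine mul_le_mul_of_nonneg_left (add_le_add_left ?_ 1) hC.le
    refine le_add_of_nonneg_right (mul_nonneg hW ?_)
    split_ifs <;> norm_num
  · rw [cost_add_mean_transition, h.bellman]
    split_ifs
    exacts [min_le_right _ _, min_le_left _ _]

theorem IsNormalizedSolution.avgCost_le (h : u.IsNormalizedSolution W θ V) (j₀ : ℕ) :
    u.avgCost W (passiveOn {j | 0 ≤ u.passiveGain W (j + 1)}) j₀ ≤ θ := by
  refine u.longRunAverage_le j₀ h.nonneg fun H j => le_of_eq ?_
  rw [h.bellman]
  by_cases hj : 0 ≤ u.passiveGain W (j + 1)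
  · rw [mean_passiveOn_of_mem (by exact hj), cost_add_mean_transition,
      min_eq_left ((h.passive_iff j).2 hj)]
    simp
  · rw [mean_passiveOn_of_notMem (by exact hj), cost_add_mean_transition,
      min_eq_right (le_of_not_ge fun h' => hj ((h.passive_iff j).1 h'))]
    simp

theorem IsNormalizedSolution.optimalValue_eq (hW : 0 ≤ W) (h : u.IsNormalizedSolution W θ V)
    (j₀ : ℕ) : u.optimalValue W j₀ = θ :=
  le_antisymm ((iInf_le _ _).trans (h.avgCost_le j₀)) (le_iInf fun φ => h.le_avgCost hW φ j₀)

theorem IsNormalizedSolution.isBellmanSolution (hW : 0 ≤ W) (h : u.IsNormalizedSolution W θ V) :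
    u.IsBellmanSolution W θ V :=
  ⟨h.optimalValue_eq hW, h.bellman, 0, by rintro _ ⟨j, rfl⟩; exact h.nonneg j⟩

end Bellman

/-! ### Uniqueness, the passive set and indexability -/

section Uniqueness

variable {u} {W θ : ℝ} {V V' : ℕ → ℝ}

/-- For a perfect channel, a state whose relative value exceeds that of the active action is itself
active: otherwise the values would decrease linearly from there on. -/
theorem eq_of_le_of_bddBelow (hρ : u.ρ = 1) (hV : BddBelow (Set.range V))
    (hb : ∀ j, θ + V j = min (u.passiveValue V j) (u.activeValue W V j)) {k : ℕ}
    (hk : W + V 0 ≤ V k) : θ + V k = u.penalty k + W + V 0 := by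
  simp only [passiveValue, activeValue, hρ, one_mul, sub_self, zero_mul, add_zero] at hb
  obtain ⟨B, hB⟩ := hV
  have hB : ∀ j, B ≤ V j := fun j => hB ⟨j, rfl⟩
  refine le_antisymm ((hb k).trans_le (min_le_right _ _)) ?_
  by_contra! hlt
  have hpen : Monotone u.penalty := by
    refine monotone_nat_of_le_succ fun j => ?_
    have := u.d_pos
    have := u.p_nonneg
    have h : u.penalty (j + 1) = u.penalty j + u.d * u.p * (j + 1) := by
      simp only [penalty]
      push_cast
      ring
    rw [h]
    exact le_add_of_nonneg_right (by positivity)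
  -- Passive at `k` despite `V k ≥ W + V 0` means the penalty already exceeds `θ`; penalties only
  -- grow, so each later slot lowers `V` by at least this gap.
  have hε : 0 < u.penalty k - θ := by linarith
  have hstep : ∀ j, θ + V j < u.penalty j + W + V 0 → V (j + 1) = V j + θ - u.penalty j := by
    intro j hj
    rcases min_choice (u.penalty j + V (j + 1)) (u.penalty j + W + V 0) with h | h <;>
      have := hb j <;> rw [h] at this <;> linarith
  have hdec : ∀ i : ℕ, θ + V (k + i) < u.penalty (k + i) + W + V 0 ∧
      V (k + i) ≤ V k - i * (u.penalty k - θ) := by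
    intro i
    induction i with
    | zero => exact ⟨hlt, by simp⟩
    | succ i ih =>
      have h1 := hstep _ ih.1
      have h2 := hpen (Nat.le_add_right k i)
      have h3 := hpen (Nat.le_add_right k (i + 1))
      rw [← add_assoc] at h3 ⊢
      push_cast
      exact ⟨by linarith [ih.1], by linarith [ih.2]⟩
  obtain ⟨i, hi⟩ := exists_nat_gt ((V k - B) / (u.penalty k - θ))
  rw [div_lt_iff₀ hε] at hi
  linarith [hB (k + i), (hdec i).2]

/-- Induction on `j`: for `ρ < 1` the minimum is strictly increasing in `V (j+1)`, hence determines
it. For `ρ = 1` the active branch ignores `V (j+1)`; where it wins, boundedness below fixes the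
value through `eq_of_le_of_bddBelow`. -/
theorem bellman_unique (hV : BddBelow (Set.range V)) (hV' : BddBelow (Set.range V'))
    (hb : ∀ j, θ + V j = min (u.passiveValue V j) (u.activeValue W V j))
    (hb' : ∀ j, θ + V' j = min (u.passiveValue V' j) (u.activeValue W V' j)) (j : ℕ) :
    V' j = V j + (V' 0 - V 0) := by
  induction j with
  | zero => ring
  | succ j ih =>
    have h := hb j
    have h' := hb' j
    rcases u.ρ_le_one.eq_or_lt with hρ | hρ
    · by_cases hk : W + V 0 ≤ V (j + 1) <;> by_cases hk' : W + V' 0 ≤ V' (j + 1)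
      · have e := eq_of_le_of_bddBelow hρ hV hb hk
        have e' := eq_of_le_of_bddBelow hρ hV' hb' hk'
        linarith
      all_goals
        simp only [passiveValue, activeValue, hρ, one_mul, sub_self, zero_mul, add_zero,
          add_assoc, min_add_add_left] at h h'
        simp only [not_le] at hk hk'
        first
          | rw [min_eq_left hk.le, min_eq_left hk'.le] at *
          | rw [min_eq_right hk, min_eq_left hk'.le] at *
          | rw [min_eq_left hk.le, min_eq_right hk'] at *
        linarith
    · have hq : 0 < 1 - u.ρ := sub_pos.2 hρ
      simp only [passiveValue, activeValue] at h h'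
      rcases lt_trichotomy (V' (j + 1)) (V (j + 1) + (V' 0 - V 0)) with hlt | heq | hlt
      · have hm := mul_lt_mul_of_pos_left hlt hq
        exfalso
        have h1 := min_le_left (u.penalty j + V' (j + 1))
          (u.penalty j + W + u.ρ * V' 0 + (1 - u.ρ) * V' (j + 1))
        have h2 := min_le_right (u.penalty j + V' (j + 1))
          (u.penalty j + W + u.ρ * V' 0 + (1 - u.ρ) * V' (j + 1))
        rcases min_choice (u.penalty j + V (j + 1))
          (u.penalty j + W + u.ρ * V 0 + (1 - u.ρ) * V (j + 1)) with e | e <;>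
          rw [e] at h <;> linarith
      · exact heq
      · have hm := mul_lt_mul_of_pos_left hlt hq
        exfalso
        have h1 := min_le_left (u.penalty j + V (j + 1))
          (u.penalty j + W + u.ρ * V 0 + (1 - u.ρ) * V (j + 1))
        have h2 := min_le_right (u.penalty j + V (j + 1))
          (u.penalty j + W + u.ρ * V 0 + (1 - u.ρ) * V (j + 1))
        rcases min_choice (u.penalty j + V' (j + 1))
          (u.penalty j + W + u.ρ * V' 0 + (1 - u.ρ) * V' (j + 1)) with e | e <;>
          rw [e] at h' <;> linarith

theorem IsBellmanSolution.unique {θ' : ℝ} (h : u.IsBellmanSolution W θ V)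
    (h' : u.IsBellmanSolution W θ' V') : θ = θ' ∧ ∃ c : ℝ, ∀ j, V' j = V j + c := by
  have hθ : θ = θ' := EReal.coe_eq_coe_iff.1 ((h.value 0).symm.trans (h'.value 0))
  subst hθ
  exact ⟨rfl, _, bellman_unique h.bddBelow h'.bddBelow h.bellman h'.bellman⟩

variable (u) in
-- The passivity test involves only differences of `V`, so the free additive constant cancels.
theorem passiveSet_eq (hW : 0 ≤ W) : u.passiveSet W = {j | 0 ≤ u.passiveGain W (j + 1)} := by
  obtain ⟨θ, V, h⟩ := u.exists_isNormalizedSolution hW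
  have hs := h.isBellmanSolution hW
  ext j
  rw [Set.mem_ofPred_eq, ← h.passive_iff]
  refine ⟨?_, fun hj => ⟨θ, V, hs, hj⟩⟩
  rintro ⟨θ', V', hs', hj⟩
  obtain ⟨-, c, hc⟩ := hs.unique hs'
  rw [passiveValue_le_activeValue_iff] at hj ⊢
  rwa [hc, hc, add_sub_add_right_eq_sub] at hj

variable (u) in
theorem indexable : u.Indexable := by
  intro W' W hW' hlt
  rw [passiveSet_eq u hW', passiveSet_eq u (hW'.trans hlt.le)]
  intro j hj
  have := div_le_div_of_nonneg_right hlt.le u.ρ_pos.le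
  simp only [Set.mem_ofPred_eq, passiveGain] at hj ⊢
  linarith

end Uniqueness

end User

/-- The first part says that `D(W)` is well defined and describes an optimal policy. -/
theorem mainTheorem3 (u : User) :
    (∀ W : ℝ, 0 ≤ W →
      (∃ (θ : ℝ) (V : ℕ → ℝ), u.IsBellmanSolution W θ V) ∧
      (∀ (θ θ' : ℝ) (V V' : ℕ → ℝ), u.IsBellmanSolution W θ V → u.IsBellmanSolution W θ' V' →
        θ = θ' ∧ ∃ c : ℝ, ∀ j, V' j = V j + c) ∧
      u.IsOptimal W (passiveOn (u.passiveSet W))) ∧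
    u.Indexable ∧
    (∀ n j₀ : ℕ,
      u.avgActiveTime (thresholdPolicy n) j₀ = ((1 / ((n : ℝ) * u.ρ + 1) : ℝ) : EReal)) ∧
    (∀ j₀ : ℕ, StrictAnti fun n : ℕ => u.avgActiveTime (thresholdPolicy n) j₀) := by
  refine ⟨fun W hW => ?_, u.indexable, u.avgActiveTime_thresholdPolicy,
    u.strictAnti_avgActiveTime_thresholdPolicy⟩
  obtain ⟨θ, V, h⟩ := u.exists_isNormalizedSolution hW
  refine ⟨⟨θ, V, h.isBellmanSolution hW⟩, fun _ _ _ _ => User.IsBellmanSolution.unique,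
    fun j₀ => ?_⟩
  rw [u.passiveSet_eq hW, h.optimalValue_eq hW]
  exact le_antisymm (h.avgCost_le j₀) (h.le_avgCost hW _ j₀)
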